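/- For positive integers $\alpha_1,\dots,\alpha_r$ with $\alpha_r\ge 2$ let \[ \zeta^\star(\alpha_1,\dots,\alpha_r)=\sum_{1\le k_1\le k_2\le\cdots\le k_r}\frac{1}{k_1^{\alpha_1}k_2^{\alpha_2}\cdots k_r^{\alpha_r}} \] be the (convergent) multiple zeta-star value, let $\{1\}^m$ denote $m$ repetitions of $1$, and let $\zeta$ be the Riemann zeta function. Let \[ D_3=\{(t_1,t_2,u_1,u_2)\in\mathbb R^4 : 0<t_1<u_1<t_2<u_2<1\}. \] For integers $m,n\ge 0$ put \[ T(m,n)=\frac1{m!\,n!}\int_{D_3}\Bigl(\log\frac{1-t_1}{1-u_2}\Bigr)^m\Bigl(\log\frac{t_2}{t_1}+\log\frac{u_2}{u_1}\Bigr)^n\frac{dt_1\,dt_2}{(1-t_1)t_2}\,\frac{du_1\,du_2}{(1-u_1)u_2}, \] and for an integer $p\ge 0$ put \[ \mathbb J(3)=\frac1{p!}\int_{D_3}\Bigl(\log\frac{1-t_1}{1-u_2}+\log\frac{t_2}{t_1}+\log\frac{u_2}{u_1}\Bigr)^p\frac{dt_1\,dt_2}{(1-t_1)t_2}\,\frac{du_1\,du_2}{(1-u_1)u_2}.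 \] These integrals converge absolutely. **Proposition.** For all integers $m,n\ge 0$, \[ T(m,n)=\sum_{\alpha_1+\alpha_2=n+3}\bigl\{\zeta^\star(\alpha_1,\{1\}^m,\alpha_2+1)-\zeta(m+n+4)\bigr\}\,(2^{\alpha_2-1}-1), \] where the sum is over pairs $(\alpha_1,\alpha_2)$ of positive integers. **Corollary.** For every integer $p\ge 0$, \[ \mathbb J(3)=\sum_{m+n=p}\ \sum_{\alpha_1+\alpha_2=n+3}\bigl\{\zeta^\star(\alpha_1,\{1\}^m,\alpha_2+1)-\zeta(p+4)\bigr\}\,(2^{\alpha_2-1}-1), \] where the outer sum is over pairs $(m,n)$ of nonnegative integers and the inner one over pairs $(\alpha_1,\alpha_2)$ of positive integers. -/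

import Mathlib

open MeasureTheory

/-- The summand `k₁^{-α₁} ⋯ k_r^{-α_r}`, for positive integers `k₁ ≤ ⋯ ≤ k_r`, of the multiple
zeta-star series of `α = (α₁, …, α_r)`. -/
noncomputable def zetaStarTerm {r : ℕ} (α : Fin r → ℕ)
    (k : {k : Fin r → ℕ+ // Monotone k}) : ℝ :=
  ∏ i, (((k.1 i : ℕ) : ℝ) ^ α i)⁻¹

/-- The multiple zeta-star value
`ζ⋆(α₁, …, α_r) = ∑_{1 ≤ k₁ ≤ ⋯ ≤ k_r} k₁^{-α₁} ⋯ k_r^{-α_r}`. -/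
noncomputable def zetaStar {r : ℕ} (α : Fin r → ℕ) : ℝ :=
  ∑' k : {k : Fin r → ℕ+ // Monotone k}, zetaStarTerm α k

/-- The index `(a, {1}^m, b)`, where `{1}^m` stands for `m` repetitions of `1`. -/
def onesBetween (a m b : ℕ) : Fin (m + 2) → ℕ :=
  Fin.cons a (Fin.snoc (fun _ : Fin m => 1) b : Fin (m + 1) → ℕ)

/-- The pairs `(α₁, α₂)` of positive integers with `α₁ + α₂ = s`. -/
def positivePairs (s : ℕ) : Finset (ℕ × ℕ) :=
  (Finset.HasAntidiagonal.antidiagonal s).filter fun α => 1 ≤ α.1 ∧ 1 ≤ α.2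

/-- The simplex `D₃ : 0 < t₁ < u₁ < t₂ < u₂ < 1`. Points of `ℝ⁴` are written in the order
`(t₁, u₁, t₂, u₂)`. -/
def D₃ : Set (ℝ × ℝ × ℝ × ℝ) :=
  {(t₁, u₁, t₂, u₂) | 0 < t₁ ∧ t₁ < u₁ ∧ u₁ < t₂ ∧ t₂ < u₂ ∧ u₂ < 1}

/-- The integrand of `T(m,n)`, with the density of `dt₁ dt₂ / ((1-t₁) t₂) · du₁ du₂ / ((1-u₁) u₂)`
included. -/
noncomputable def integrandT (m n : ℕ) : ℝ × ℝ × ℝ × ℝ → ℝ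
  | (t₁, u₁, t₂, u₂) =>
    (Real.log ((1 - t₁) / (1 - u₂))) ^ m *
      (Real.log (t₂ / t₁) + Real.log (u₂ / u₁)) ^ n *
      (1 / ((1 - t₁) * t₂)) * (1 / ((1 - u₁) * u₂))

/-- `T(m,n)`. -/
noncomputable def T (m n : ℕ) : ℝ :=
  1 / ((m.factorial : ℝ) * (n.factorial : ℝ)) * ∫ x in D₃, integrandT m n x

/-- The integrand of `𝕁(3)` for the parameter `p`, with the density of
`dt₁ dt₂ / ((1-t₁) t₂) · du₁ du₂ / ((1-u₁) u₂)` included. -/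
noncomputable def integrandJ (p : ℕ) : ℝ × ℝ × ℝ × ℝ → ℝ
  | (t₁, u₁, t₂, u₂) =>
    (Real.log ((1 - t₁) / (1 - u₂)) + Real.log (t₂ / t₁) + Real.log (u₂ / u₁)) ^ p *
      (1 / ((1 - t₁) * t₂)) * (1 / ((1 - u₁) * u₂))

/-- `𝕁(3)` for the parameter `p`. -/
noncomputable def J₃ (p : ℕ) : ℝ :=
  1 / (p.factorial : ℝ) * ∫ x in D₃, integrandJ p x

/-! The proof compares generating functions, with `x` marking `m` and `y` marking `n`. Summing `x^m
y^n T(m,n)` turns the logarithms into `((1-t₁)/(1-u₂))^x (t₂u₂/(t₁u₁))^y`. Expand `(1-t₁)^(x-1)`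
with index `j` and `1/(1-u₁)` with index `l`; what remains on `D₃` is three power integrals and a
Beta integral (`lintegral_D₃_rpow`). With `k = j+l+1`, the Beta value times the binomial coefficient
collapses to `1/(k+1) · ∏_{j≤i≤k} (1 - x/(i+1))⁻¹`, so `tsum_lintegralT_eq` gives a sum over `j <
k`.

That product generates the sums over chains `j ≤ i₁ ≤ ⋯ ≤ iₘ ≤ k`, which are the block `{1}^m`
(`tsum_pow_mul_chainSum`). The other factors, `1/(j+1-y)` and `1/((k+1-2y)(k+1-y))`, expand in `y`
into the outer powers and the weights `2^(α₂-1)-1`. Since `j < k` is strict, the diagonal `j = k` of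
the zeta-star series is missing, and this diagonal is the subtracted zeta value.

All interchanges take place in `ℝ≥0∞`. Convergence enters through one bound at `x = 1/4`, after
which the identity theorem compares coefficients (`eq_of_tsum_pow_eq`). -/

open scoped ENNReal
open Finset.HasAntidiagonal (antidiagonal mem_antidiagonal)

namespace ZetaStar

/-! ### Chain sums and their generating product. -/

/-- The weight `1 / (i + 1)` as an extended nonnegative real. -/
noncomputable def invSucc (i : ℕ) : ℝ≥0∞ := ((i : ℝ≥0∞) + 1)⁻¹

/-- The sum of `∏ 1 / (iₗ + 1)` over all chains `j ≤ i₁ ≤ ⋯ ≤ iₘ ≤ k`. -/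
noncomputable def chainSum : ℕ → ℕ → ℕ → ℝ≥0∞
  | 0, _, _ => 1
  | m + 1, j, k => ∑ i ∈ Finset.Icc j k, invSucc i * chainSum m i k

/-- The generating product `∏_{j ≤ i ≤ k} (1 - x / (i + 1))⁻¹` of the chain sums. -/
noncomputable def chainProd (x : ℝ≥0∞) (j k : ℕ) : ℝ≥0∞ :=
  ∏ i ∈ Finset.Icc j k, (1 - x * invSucc i)⁻¹

lemma tsum_pow_mul_tsum_pow (x : ℝ≥0∞) (a b : ℕ → ℝ≥0∞) :
    (∑' n, x ^ n * a n) * (∑' n, x ^ n * b n) =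
      ∑' n, x ^ n * ∑ p ∈ antidiagonal n, a p.1 * b p.2 := by
  have h1 : (∑' n, x ^ n * a n) * (∑' n, x ^ n * b n) =
      ∑' p : ℕ × ℕ, x ^ (p.1 + p.2) * (a p.1 * b p.2) := by
    rw [ENNReal.tsum_prod (f := fun i j => x ^ (i + j) * (a i * b j)), ← ENNReal.tsum_mul_right]
    refine tsum_congr fun i => ?_
    rw [← ENNReal.tsum_mul_left]
    refine tsum_congr fun j => ?_
    rw [pow_add]; ring
  rw [h1, ← Finset.HasAntidiagonal.sigmaAntidiagonalEquivProd.tsum_eq, ENNReal.tsum_sigma']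
  refine tsum_congr fun n => ?_
  rw [tsum_fintype, Finset.mul_sum, ← Finset.sum_coe_sort (antidiagonal n)]
  refine Finset.sum_congr rfl fun p _ => ?_
  have := mem_antidiagonal.1 p.2
  simp [this]

lemma chainSum_of_lt {m j k : ℕ} (h : k < j) : chainSum (m + 1) j k = 0 := by
  simp [chainSum, Finset.Icc_eq_empty_of_lt h]

lemma chainSum_succ_left {j k : ℕ} (m : ℕ) (h : j ≤ k) :
    chainSum (m + 1) j k = invSucc j * chainSum m j k + chainSum (m + 1) (j + 1) k := by
  rw [chainSum, ← Finset.insert_Icc_add_one_left_eq_Icc h, Finset.sum_insert (by simp), chainSum]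

/-- Sort the chains by the number `p.1` of leading entries equal to `j`. -/
lemma chainSum_eq_sum_antidiagonal {j k : ℕ} (m : ℕ) (h : j ≤ k) :
    chainSum m j k =
      ∑ p ∈ antidiagonal m, invSucc j ^ p.1 * chainSum p.2 (j + 1) k := by
  induction m with
  | zero => simp [chainSum]
  | succ m ih =>
    rw [chainSum_succ_left m h, Finset.Nat.antidiagonal_succ, Finset.sum_cons, ih,
      Finset.sum_map, Finset.mul_sum, add_comm]
    simp [pow_succ', mul_assoc]

/-- Induction on the length of `[j, k]`: removing `j` splits off a geometric series. Every `x` is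
allowed, since with truncated subtraction and `0⁻¹ = ∞` the geometric sum formula also covers
divergence. -/
lemma tsum_pow_mul_chainSum (x : ℝ≥0∞) (j k : ℕ) :
    ∑' m, x ^ m * chainSum m j k = chainProd x j k := by
  induction hN : k + 1 - j generalizing j with
  | zero =>
    rw [tsum_eq_single 0]
    · simp [chainSum, chainProd, Finset.Icc_eq_empty_of_lt (show k < j by omega)]
    · intro m hm
      obtain ⟨m, rfl⟩ := Nat.exists_eq_succ_of_ne_zero hm
      simp [chainSum_of_lt (show k < j by omega)]
  | succ N ih =>
    have h : j ≤ k := by omega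
    have hg : ∑' n, x ^ n * invSucc j ^ n = (1 - x * invSucc j)⁻¹ := by
      simp_rw [← mul_pow]
      exact ENNReal.tsum_geometric _
    rw [chainProd, ← Finset.insert_Icc_add_one_left_eq_Icc h, Finset.prod_insert (by simp),
      ← chainProd, ← ih (j + 1) (by omega), ← hg, tsum_pow_mul_tsum_pow]
    exact tsum_congr fun m => by rw [chainSum_eq_sum_antidiagonal m h]

lemma chainSum_self (m k : ℕ) : chainSum m k k = invSucc k ^ m := by
  induction m with
  | zero => simp [chainSum]
  | succ m ih => simp [chainSum, ih, pow_succ']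

/-! ### The zeta-star series as a sum over `ℕ`-valued tuples. -/

open Classical in
/-- The sum of `∏ (kᵢ + 1) ^ (-αᵢ)` over all monotone tuples with entries at least `j`. -/
noncomputable def tupleSum {n : ℕ} (α : Fin n → ℕ) (j : ℕ) : ℝ≥0∞ :=
  ∑' k : Fin n → ℕ, if Monotone k ∧ ∀ i, j ≤ k i then ∏ i, invSucc (k i) ^ α i else 0

lemma monotone_cons_iff {n : ℕ} (i : ℕ) (t : Fin n → ℕ) :
    Monotone (Fin.cons i t : Fin (n + 1) → ℕ) ↔ Monotone t ∧ ∀ l, i ≤ t l := by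
  constructor
  · intro h
    refine ⟨fun a b hab => ?_, fun l => ?_⟩
    · simpa using h (Fin.succ_le_succ_iff.2 hab)
    · simpa using h (Fin.zero_le l.succ)
  · rintro ⟨h1, h2⟩ a b hab
    induction a using Fin.cases with
    | zero => induction b using Fin.cases with
      | zero => simp
      | succ b => simpa using h2 b
    | succ a => induction b using Fin.cases with
      | zero => simp at hab
      | succ b => simpa using h1 (Fin.succ_le_succ_iff.1 hab)

/-- The lower bound `j` exists for this recursion: the first entry becomes the lower bound of the
others. -/
lemma tupleSum_cons {n : ℕ} (a : ℕ) (β : Fin n → ℕ) (j : ℕ) :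
    tupleSum (Fin.cons a β : Fin (n + 1) → ℕ) j =
      ∑' i, if j ≤ i then invSucc i ^ a * tupleSum β i else 0 := by
  classical
  rw [tupleSum, ← (Fin.consEquiv fun _ => ℕ).tsum_eq, ENNReal.tsum_prod']
  refine tsum_congr fun i => ?_
  split_ifs with h
  · rw [tupleSum, ← ENNReal.tsum_mul_left]
    refine tsum_congr fun t => ?_
    rw [mul_ite, mul_zero]
    refine if_congr ?_ ?_ rfl
    · change Monotone (Fin.cons i t : Fin (n + 1) → ℕ) ∧
        (∀ l, j ≤ (Fin.cons i t : Fin (n + 1) → ℕ) l) ↔ _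
      simp only [monotone_cons_iff, Fin.forall_fin_succ, Fin.cons_zero, Fin.cons_succ]
      exact ⟨fun h' => h'.1, fun h' => ⟨h', h, fun l => h.trans (h'.2 l)⟩⟩
    · simp [Fin.prod_univ_succ]
  · refine ENNReal.tsum_eq_zero.2 fun t => if_neg fun h' => h ?_
    simpa using h'.2 0

lemma tupleSum_elim0 (β : Fin 0 → ℕ) (j : ℕ) : tupleSum β j = 1 := by
  rw [tupleSum, tsum_fintype]
  simp [Subsingleton.monotone]

/-- The ones are removed from the left, and each interchange of sums keeps the largest entry `k`
outermost. -/
lemma tupleSum_snoc_ones (m b j : ℕ) :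
    tupleSum (Fin.snoc (fun _ : Fin m => 1) b : Fin (m + 1) → ℕ) j =
      ∑' k, if j ≤ k then invSucc k ^ b * chainSum m j k else 0 := by
  induction m generalizing j with
  | zero =>
    have : (Fin.snoc (fun _ : Fin 0 => 1) b : Fin 1 → ℕ) = Fin.cons b Fin.elim0 := by
      ext i; fin_cases i; rfl
    rw [this, tupleSum_cons]
    simp [tupleSum_elim0, chainSum]
  | succ m ih =>
    have : (Fin.snoc (fun _ : Fin (m + 1) => 1) b : Fin (m + 2) → ℕ) =
        Fin.cons 1 (Fin.snoc (fun _ : Fin m => 1) b : Fin (m + 1) → ℕ) := by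
      rw [Fin.cons_snoc_eq_snoc_cons]
      congr 1
      ext i
      induction i using Fin.cases <;> simp
    rw [this, tupleSum_cons]
    have h1 : ∀ i, (if j ≤ i then invSucc i ^ 1 *
          tupleSum (Fin.snoc (fun _ : Fin m => 1) b : Fin (m + 1) → ℕ) i else 0) =
        ∑' k, if j ≤ i ∧ i ≤ k then invSucc k ^ b * (invSucc i * chainSum m i k) else 0 := by
      intro i
      by_cases h : j ≤ i
      · simp only [h, if_true, true_and, ih, pow_one, ← ENNReal.tsum_mul_left, mul_ite, mul_zero,
          mul_left_comm]
      · simp [h]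
    rw [tsum_congr h1, ENNReal.tsum_comm]
    refine tsum_congr fun k => ?_
    rw [tsum_eq_sum (s := Finset.Icc j k)]
    · rw [chainSum, Finset.mul_sum, Finset.sum_congr rfl fun i hi => if_pos (Finset.mem_Icc.1 hi)]
      split_ifs with h
      · rfl
      · simp [Finset.Icc_eq_empty h]
    · intro i hi
      exact if_neg fun h => hi (Finset.mem_Icc.2 h)

/-- When the extreme entries agree, all entries agree, so the diagonal is a plain zeta series. -/
lemma tupleSum_onesBetween (a m b : ℕ) :
    tupleSum (onesBetween a m b) 0 =
      (∑' k, invSucc k ^ (a + m + b)) +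
        ∑' j, ∑' k, if j < k then invSucc j ^ a * (invSucc k ^ b * chainSum m j k) else 0 := by
  rw [onesBetween, tupleSum_cons, ← ENNReal.tsum_add]
  refine tsum_congr fun j => ?_
  rw [if_pos j.zero_le, tupleSum_snoc_ones, ← ENNReal.tsum_mul_left,
    ← tsum_ite_eq j (fun k => invSucc k ^ (a + m + b)), ← ENNReal.tsum_add]
  refine tsum_congr fun k => ?_
  rcases lt_trichotomy j k with h | rfl | h
  · simp [h.le, h, h.ne']
  · simp [chainSum_self, pow_add]
    ring
  · simp [h.not_ge, h.not_gt, h.ne]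

lemma ofReal_inv_pow (k : ℕ+) (a : ℕ) :
    ENNReal.ofReal ((((k : ℕ) : ℝ) ^ a)⁻¹) = invSucc k.natPred ^ a := by
  have h : (0 : ℝ) < (k : ℕ) := by exact_mod_cast k.pos
  rw [invSucc, ← inv_pow, ENNReal.ofReal_pow (by positivity), ENNReal.ofReal_inv_of_pos h,
    ENNReal.ofReal_natCast]
  congr 2
  exact_mod_cast (PNat.natPred_add_one k).symm

lemma tsum_ofReal_zetaStarTerm {r : ℕ} (α : Fin r → ℕ) :
    ∑' k, ENNReal.ofReal (zetaStarTerm α k) = tupleSum α 0 := by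
  classical
  let e : {k : Fin r → ℕ+ // Monotone k} ≃ {k : Fin r → ℕ // Monotone k} :=
    Equiv.subtypeEquiv (Equiv.piCongrRight fun _ => Equiv.pnatEquivNat) fun k => by
      refine ⟨fun h a b hab => PNat.natPred_monotone (h hab), fun h a b hab => ?_⟩
      exact PNat.natPred_le_natPred.1 (h hab)
  have h1 : ∀ k, ENNReal.ofReal (zetaStarTerm α k) = ∏ i, invSucc ((e k).1 i) ^ α i := by
    intro k
    rw [zetaStarTerm, ENNReal.ofReal_prod_of_nonneg fun i _ => by positivity]
    exact Finset.prod_congr rfl fun i _ => ofReal_inv_pow _ _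
  rw [tsum_congr h1, e.tsum_eq (fun k => ∏ i, invSucc (k.1 i) ^ α i), tupleSum]
  rw [← tsum_subtype_eq_of_support_subset (s := {k : Fin r → ℕ | Monotone k})]
  · exact tsum_congr fun k => by rw [if_pos ⟨k.2, fun _ => Nat.zero_le _⟩]
  · intro k hk
    by_contra h
    exact hk (if_neg fun h' => h h'.1)

/-! ### Closed forms of the generating functions in one variable. -/

lemma invSucc_eq_ofReal (i : ℕ) : invSucc i = ENNReal.ofReal (1 / ((i : ℝ) + 1)) := by
  have h : (0 : ℝ) < (i : ℝ) + 1 := by positivity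
  rw [invSucc, one_div, ENNReal.ofReal_inv_of_pos h, ENNReal.ofReal_add (by positivity) zero_le_one,
    ENNReal.ofReal_natCast, ENNReal.ofReal_one]

lemma div_succ_lt_one {x : ℝ} (hx1 : x < 1) (i : ℕ) : x / ((i : ℝ) + 1) < 1 := by
  have h : (0 : ℝ) ≤ (i : ℝ) := by positivity
  rw [div_lt_one (by positivity)]
  linarith

lemma chainProd_ofReal {x : ℝ} (hx0 : 0 ≤ x) (hx1 : x < 1) (j k : ℕ) :
    chainProd (ENNReal.ofReal x) j k =
      ENNReal.ofReal (∏ i ∈ Finset.Icc j k, (1 - x / ((i : ℝ) + 1))⁻¹) := by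
  have h (i : ℕ) : 0 < 1 - x / ((i : ℝ) + 1) := sub_pos.2 (div_succ_lt_one hx1 i)
  rw [chainProd, ENNReal.ofReal_prod_of_nonneg fun i _ => (inv_pos.2 (h i)).le]
  refine Finset.prod_congr rfl fun i _ => ?_
  rw [invSucc_eq_ofReal, ← ENNReal.ofReal_mul hx0, mul_one_div, ENNReal.ofReal_inv_of_pos (h i),
    ENNReal.ofReal_sub _ (by positivity), ENNReal.ofReal_one]

lemma tsum_pow_mul_invSucc_pow {x : ℝ} (hx0 : 0 ≤ x) (hx1 : x < 1) (j : ℕ) :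
    ∑' d, ENNReal.ofReal x ^ d * invSucc j ^ (d + 1) =
      ENNReal.ofReal (1 / ((j : ℝ) + 1 - x)) := by
  have hj : (0 : ℝ) < (j : ℝ) + 1 := by positivity
  have hq := div_succ_lt_one hx1 j
  have hs := (hasSum_geometric_of_lt_one (div_nonneg hx0 hj.le) hq).mul_right (1 / ((j : ℝ) + 1))
  have he : (1 - x / ((j : ℝ) + 1))⁻¹ * (1 / ((j : ℝ) + 1)) = 1 / ((j : ℝ) + 1 - x) := by
    rw [one_div, ← mul_inv, one_div]
    congr 1
    field_simp
  rw [he] at hs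
  rw [← hs.tsum_eq, ENNReal.ofReal_tsum_of_nonneg (fun n => by positivity) hs.summable]
  refine tsum_congr fun d => ?_
  rw [invSucc_eq_ofReal, ← ENNReal.ofReal_pow hx0, ← ENNReal.ofReal_pow (by positivity),
    ← ENNReal.ofReal_mul (by positivity)]
  congr 1
  rw [div_pow, div_pow, one_pow, pow_succ]
  field_simp

/-- With `K = k+1`, the right side is `2/(K(K-2x)) - 1/(K(K-x))`, a difference of two geometric
series. This is the source of the weights `2^(α₂-1)-1`. -/
lemma tsum_pow_mul_two_pow_sub_one {x : ℝ} (hx0 : 0 ≤ x) (hx1 : 2 * x < 1) (k : ℕ) :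
    ∑' c, ENNReal.ofReal x ^ c * (ENNReal.ofReal (2 ^ (c + 1) - 1) * invSucc k ^ (c + 2)) =
      ENNReal.ofReal (1 / (((k : ℝ) + 1 - 2 * x) * ((k : ℝ) + 1 - x))) := by
  have hk0 : (0 : ℝ) ≤ (k : ℝ) := by positivity
  have hk : (0 : ℝ) < (k : ℝ) + 1 := by positivity
  have hs := ((hasSum_geometric_of_lt_one (div_nonneg (by positivity) hk.le)
    (div_succ_lt_one hx1 k)).mul_right (2 / ((k : ℝ) + 1) ^ 2)).sub
    ((hasSum_geometric_of_lt_one (div_nonneg hx0 hk.le)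
    (div_succ_lt_one (by linarith : x < 1) k)).mul_right (1 / ((k : ℝ) + 1) ^ 2))
  have h1 : (k : ℝ) + 1 - 2 * x ≠ 0 := by linarith
  have h2 : (k : ℝ) + 1 - x ≠ 0 := by linarith
  have he : (1 - 2 * x / ((k : ℝ) + 1))⁻¹ * (2 / ((k : ℝ) + 1) ^ 2) -
      (1 - x / ((k : ℝ) + 1))⁻¹ * (1 / ((k : ℝ) + 1) ^ 2) =
      1 / (((k : ℝ) + 1 - 2 * x) * ((k : ℝ) + 1 - x)) := by
    have e1 : 1 - 2 * x / ((k : ℝ) + 1) = ((k : ℝ) + 1 - 2 * x) / ((k : ℝ) + 1) := by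
      field_simp
    have e2 : 1 - x / ((k : ℝ) + 1) = ((k : ℝ) + 1 - x) / ((k : ℝ) + 1) := by
      field_simp
    rw [e1, e2]
    field_simp
    ring
  have ht : ∀ c : ℕ, (2 * x / ((k : ℝ) + 1)) ^ c * (2 / ((k : ℝ) + 1) ^ 2) -
      (x / ((k : ℝ) + 1)) ^ c * (1 / ((k : ℝ) + 1) ^ 2) =
      x ^ c * ((2 ^ (c + 1) - 1) * (1 / ((k : ℝ) + 1)) ^ (c + 2)) := by
    intro c
    simp only [div_pow, mul_pow, one_pow, pow_add]
    field_simp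
  have hp : ∀ c : ℕ, (0 : ℝ) ≤ 2 ^ (c + 1) - 1 := fun c =>
    sub_nonneg.2 (one_le_pow₀ (by norm_num))
  rw [he] at hs
  simp_rw [ht] at hs
  rw [← hs.tsum_eq, ENNReal.ofReal_tsum_of_nonneg
    (fun c => mul_nonneg (by positivity) (mul_nonneg (hp c) (by positivity))) hs.summable]
  refine tsum_congr fun c => ?_
  rw [invSucc_eq_ofReal, ← ENNReal.ofReal_pow hx0, ← ENNReal.ofReal_pow (by positivity),
    ← ENNReal.ofReal_mul (hp c), ← ENNReal.ofReal_mul (by positivity)]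

/-! ### Convergence at `x = 1/4`. -/

lemma inv_one_sub_quarter_le (i : ℕ) :
    (1 - 1 / 4 / ((i : ℝ) + 1))⁻¹ ≤ √(((i : ℝ) + 2) / ((i : ℝ) + 1)) := by
  have hi : (0 : ℝ) ≤ (i : ℝ) := by positivity
  refine Real.le_sqrt_of_sq_le ?_
  have e : (1 - 1 / 4 / ((i : ℝ) + 1))⁻¹ = (4 * ((i : ℝ) + 1)) / (4 * (i : ℝ) + 3) := by
    rw [inv_eq_iff_eq_inv, inv_div]
    field_simp
    ring
  rw [e, div_pow, div_le_div_iff₀ (by positivity) (by positivity)]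
  nlinarith [pow_nonneg hi 2, pow_nonneg hi 3]

/-- The factorwise bounds `√((i+2)/(i+1))` telescope. -/
lemma prod_inv_one_sub_quarter_le {j k : ℕ} (h : j ≤ k) :
    ∏ i ∈ Finset.Icc j k, (1 - 1 / 4 / ((i : ℝ) + 1))⁻¹ ≤
      √(((k : ℝ) + 2) / ((j : ℝ) + 1)) := by
  induction k, h using Nat.le_induction with
  | base => simpa using inv_one_sub_quarter_le j
  | succ k h ih =>
    have hp i : (0 : ℝ) < 1 - 1 / 4 / ((i : ℕ) + 1 : ℝ) :=
      sub_pos.2 (div_succ_lt_one (by norm_num) i)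
    rw [← Finset.insert_Icc_right_eq_Icc_add_one (by omega), Finset.prod_insert (by simp)]
    refine (mul_le_mul (inv_one_sub_quarter_le (k + 1)) ih
      (Finset.prod_nonneg fun i _ => (inv_pos.2 (hp i)).le) (Real.sqrt_nonneg _)).trans
      (le_of_eq ?_)
    rw [← Real.sqrt_mul (by positivity)]
    congr 1
    push_cast
    field_simp
    ring

lemma tsum_ofReal_succ_rpow_ne_top :
    ∑' j : ℕ, ENNReal.ofReal (1 / |(j : ℝ) + 1| ^ (3 / 2 : ℝ)) ≠ ∞ :=
  ((Real.summable_one_div_nat_add_rpow 1 (3 / 2)).2 (by norm_num)).tsum_ofReal_ne_top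

/-- The square root bound moves half a power from `k` to `j`, leaving a product of two series with
exponent `3/2`. The diagonal is included so that the same bound also gives convergence of the
zeta-star series. -/
lemma tsum_chainProd_ne_top :
    ∑' j, ∑' k, (if j ≤ k then
      invSucc j * (invSucc k ^ 2 * chainProd (ENNReal.ofReal (1 / 4)) j k) else 0) ≠ ∞ := by
  have hb : ∀ j k : ℕ, (if j ≤ k then
      invSucc j * (invSucc k ^ 2 * chainProd (ENNReal.ofReal (1 / 4)) j k) else 0) ≤
      ENNReal.ofReal (1 / |(j : ℝ) + 1| ^ (3 / 2 : ℝ)) *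
        (2 * ENNReal.ofReal (1 / |(k : ℝ) + 1| ^ (3 / 2 : ℝ))) := by
    intro j k
    split_ifs with h
    · have hj : (0 : ℝ) < (j : ℝ) + 1 := by positivity
      have hk : (0 : ℝ) < (k : ℝ) + 1 := by positivity
      have e2 : (2 : ℝ≥0∞) = ENNReal.ofReal 2 := by simp
      rw [chainProd_ofReal (by norm_num) (by norm_num), invSucc_eq_ofReal, invSucc_eq_ofReal, e2,
        ← ENNReal.ofReal_pow (by positivity), ← ENNReal.ofReal_mul (by positivity),
        ← ENNReal.ofReal_mul (by positivity), ← ENNReal.ofReal_mul (by positivity),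
        ← ENNReal.ofReal_mul (by positivity), abs_of_pos hj, abs_of_pos hk]
      refine ENNReal.ofReal_le_ofReal ?_
      have hr : ∀ y : ℝ, 0 < y → y ^ (3 / 2 : ℝ) = y * √y := fun y hy => by
        rw [Real.sqrt_eq_rpow, ← Real.rpow_one_add' hy.le (by norm_num)]
        norm_num
      rw [hr _ hj, hr _ hk]
      have hle : √(((k : ℝ) + 2) / ((j : ℝ) + 1)) ≤ 2 * √((k : ℝ) + 1) / √((j : ℝ) + 1) := by
        rw [Real.sqrt_div (by positivity)]
        gcongr
        refine Real.sqrt_le_iff.2 ⟨by positivity, ?_⟩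
        rw [mul_pow, Real.sq_sqrt hk.le]
        linarith
      calc _ ≤ 1 / ((j : ℝ) + 1) * ((1 / ((k : ℝ) + 1)) ^ 2 *
            (2 * √((k : ℝ) + 1) / √((j : ℝ) + 1))) := by
            gcongr
            exact (prod_inv_one_sub_quarter_le h).trans hle
        _ = _ := by
            have hsj : 0 < √((j : ℝ) + 1) := Real.sqrt_pos.2 hj
            have hsk : 0 < √((k : ℝ) + 1) := Real.sqrt_pos.2 hk
            field_simp
            rw [Real.sq_sqrt hk.le]
    · exact zero_le
  refine ne_top_of_le_ne_top ?_
    (ENNReal.tsum_le_tsum fun j => ENNReal.tsum_le_tsum fun k => hb j k)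
  simp_rw [ENNReal.tsum_mul_left, ENNReal.tsum_mul_right]
  exact ENNReal.mul_ne_top tsum_ofReal_succ_rpow_ne_top
    (ENNReal.mul_ne_top (by simp) tsum_ofReal_succ_rpow_ne_top)

/-! ### Comparison of coefficients. -/

lemma ne_top_of_tsum_pow_ne_top {a : ℕ → ℝ≥0∞} {r : ℝ} (hr : 0 < r)
    (h : ∑' n, ENNReal.ofReal r ^ n * a n ≠ ∞) (n : ℕ) : a n ≠ ∞ := by
  intro hn
  refine ENNReal.ne_top_of_tsum_ne_top h n ?_
  rw [hn, ENNReal.mul_top]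
  exact pow_ne_zero _ (by simpa using hr)

/-- Finiteness at `r` makes both sides real power series with positive radius. They agree on `(0,
r]`, which accumulates at `0`, so the identity theorem applies; no negative argument is needed. -/
lemma eq_of_tsum_pow_eq {a b : ℕ → ℝ≥0∞} {r : ℝ} (hr : 0 < r)
    (hfin : ∑' n, ENNReal.ofReal r ^ n * a n ≠ ∞)
    (h : ∀ x : ℝ, 0 < x → x ≤ r →
      ∑' n, ENNReal.ofReal x ^ n * a n = ∑' n, ENNReal.ofReal x ^ n * b n) : a = b := by
  have hfin' : ∑' n, ENNReal.ofReal r ^ n * b n ≠ ∞ := h r hr le_rfl ▸ hfin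
  have key : ∀ c : ℕ → ℝ≥0∞, ∑' n, ENNReal.ofReal r ^ n * c n ≠ ∞ →
      HasFPowerSeriesAt (fun x => ∑' n, (c n).toReal * x ^ n)
        (FormalMultilinearSeries.ofScalars ℝ fun n => (c n).toReal) 0 := by
    intro c hc
    have hs : Summable fun n => (c n).toReal * r ^ n := by
      refine (ENNReal.summable_toReal hc).congr fun n => ?_
      rw [ENNReal.toReal_mul, ENNReal.toReal_pow, ENNReal.toReal_ofReal hr.le, mul_comm]
    have hrad : (r.toNNReal : ℝ≥0∞) ≤
        (FormalMultilinearSeries.ofScalars ℝ fun n => (c n).toReal).radius := by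
      apply FormalMultilinearSeries.le_radius_of_summable
      simpa [FormalMultilinearSeries.ofScalars_norm, abs_of_nonneg, hr.le] using hs
    have := (FormalMultilinearSeries.ofScalars ℝ fun n => (c n).toReal).hasFPowerSeriesOnBall
      (lt_of_lt_of_le (by simpa using hr) hrad)
    convert this.hasFPowerSeriesAt using 1
    ext x
    simp [FormalMultilinearSeries.sum, mul_comm]
  have ha := key a hfin
  have hb := key b hfin'
  have hev : ∀ x : ℝ, 0 < x → x ≤ r →
      ∑' n, (a n).toReal * x ^ n = ∑' n, (b n).toReal * x ^ n := by
    intro x hx hxr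
    have e : ∀ c : ℕ → ℝ≥0∞, ∑' n, ENNReal.ofReal r ^ n * c n ≠ ∞ →
        (∑' n, ENNReal.ofReal x ^ n * c n).toReal = ∑' n, (c n).toReal * x ^ n := by
      intro c hc
      rw [ENNReal.tsum_toReal_eq fun n => ENNReal.mul_ne_top (by simp)
        (ne_top_of_tsum_pow_ne_top hr hc n)]
      refine tsum_congr fun n => ?_
      rw [ENNReal.toReal_mul, ENNReal.toReal_pow, ENNReal.toReal_ofReal hx.le, mul_comm]
    rw [← e a hfin, ← e b hfin', h x hx hxr]
  have hfreq : ∃ᶠ x in nhdsWithin (0 : ℝ) {0}ᶜ,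
      ∑' n, (a n).toReal * x ^ n = ∑' n, (b n).toReal * x ^ n := by
    have h1 : ∀ᶠ x in nhdsWithin (0 : ℝ) (Set.Ioi 0),
        ∑' n, (a n).toReal * x ^ n = ∑' n, (b n).toReal * x ^ n := by
      filter_upwards [Ioc_mem_nhdsGT hr] with x hx using hev x hx.1 hx.2
    exact h1.frequently.filter_mono (nhdsWithin_mono _ fun x hx => ne_of_gt hx)
  have heq := (AnalyticAt.frequently_eq_iff_eventually_eq ha.analyticAt hb.analyticAt).1 hfreq
  have hser := (ha.congr heq).eq_formalMultilinearSeries hb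
  have hcoef := (FormalMultilinearSeries.ofScalars_series_eq_iff (𝕜 := ℝ) ℝ _ _).1 hser
  ext1 n
  exact (ENNReal.toReal_eq_toReal_iff' (ne_top_of_tsum_pow_ne_top hr hfin n)
    (ne_top_of_tsum_pow_ne_top hr hfin' n)).1 (congrFun hcoef n)

/-! ### Iterated integration over `D₃`. -/

/-- The primitive `∫₀ˢ f` of a nonnegative function. -/
noncomputable def primitive (f : ℝ → ℝ≥0∞) (s : ℝ) : ℝ≥0∞ := ∫⁻ t in Set.Ioo 0 s, f t

lemma measurable_indicator_Ioo {f : ℝ → ℝ≥0∞} (hf : Measurable f) :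
    Measurable fun z : ℝ × ℝ => (Set.Ioo 0 z.2).indicator f z.1 := by
  have : (fun z : ℝ × ℝ => (Set.Ioo 0 z.2).indicator f z.1) =
      {z : ℝ × ℝ | 0 < z.1 ∧ z.1 < z.2}.indicator fun z => f z.1 := by
    ext z
    simp only [Set.indicator, Set.mem_Ioo, Set.mem_ofPred_eq]
  rw [this]
  exact (hf.comp measurable_fst).indicator
    ((measurableSet_lt measurable_const measurable_fst).inter
      (measurableSet_lt measurable_fst measurable_snd))

lemma measurable_primitive {f : ℝ → ℝ≥0∞} (hf : Measurable f) : Measurable (primitive f) := by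
  have h := ((measurable_indicator_Ioo hf).comp measurable_swap).lintegral_prod_right'
    (ν := (volume : Measure ℝ))
  convert h using 2 with s
  rw [primitive, ← lintegral_indicator measurableSet_Ioo]
  rfl

/-- Tonelli for a variable whose upper limit depends on the others; each use removes one coordinate
of `D₃`. -/
lemma lintegral_indicator_mul {Y : Type*} [MeasurableSpace Y] {ν : Measure Y} [SFinite ν]
    {f : ℝ → ℝ≥0∞} (hf : Measurable f) {φ : Y → ℝ} (hφ : Measurable φ) {R : Y → ℝ≥0∞}
    (hR : Measurable R) :
    ∫⁻ z : ℝ × Y, (Set.Ioo 0 (φ z.2)).indicator f z.1 * R z.2 ∂(volume.prod ν) =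
      ∫⁻ y, primitive f (φ y) * R y ∂ν := by
  have hm : Measurable fun z : ℝ × Y => (Set.Ioo 0 (φ z.2)).indicator f z.1 :=
    (measurable_indicator_Ioo hf).comp (measurable_fst.prodMk (hφ.comp measurable_snd))
  refine (lintegral_prod_symm' _ (hm.mul (hR.comp measurable_snd))).trans ?_
  refine lintegral_congr fun y => ?_
  simp only [Pi.mul_apply, Function.comp_apply]
  rw [lintegral_mul_const _ (hf.indicator measurableSet_Ioo),
    lintegral_indicator measurableSet_Ioo, primitive]

lemma measurableSet_D₃ : MeasurableSet D₃ := by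
  have : D₃ = {x : ℝ × ℝ × ℝ × ℝ | 0 < x.1} ∩ ({x | x.1 < x.2.1} ∩ ({x | x.2.1 < x.2.2.1} ∩
      ({x | x.2.2.1 < x.2.2.2} ∩ {x | x.2.2.2 < 1}))) := rfl
  rw [this]
  refine (measurableSet_lt ?_ ?_).inter ((measurableSet_lt ?_ ?_).inter
    ((measurableSet_lt ?_ ?_).inter ((measurableSet_lt ?_ ?_).inter (measurableSet_lt ?_ ?_))))
    <;> fun_prop

lemma lintegral_D₃_mul {f₁ f₂ f₃ f₄ : ℝ → ℝ≥0∞} (h₁ : Measurable f₁) (h₂ : Measurable f₂)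
    (h₃ : Measurable f₃) (h₄ : Measurable f₄) :
    ∫⁻ x in D₃, f₁ x.1 * (f₂ x.2.1 * (f₃ x.2.2.1 * f₄ x.2.2.2)) =
      primitive (fun u => primitive (fun t => primitive (fun s => primitive f₁ s * f₂ s) t * f₃ t) u
        * f₄ u) 1 := by
  have hswap : ∀ (f g : ℝ → ℝ≥0∞) (s t : ℝ), g t * (Set.Ioo 0 s).indicator f t =
      (Set.Ioo 0 s).indicator (fun t => g t * f t) t := fun f g s t => by
    simp only [Set.indicator, mul_ite, mul_zero]
  have m₁ := measurable_primitive h₁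
  have m₂ := measurable_primitive (m₁.mul h₂)
  have m₃ := measurable_primitive (m₂.mul h₃)
  have k₂ := measurable_indicator_Ioo h₂
  have k₃ := measurable_indicator_Ioo h₃
  have k₄ : Measurable ((Set.Ioo (0 : ℝ) 1).indicator f₄) := h₄.indicator measurableSet_Ioo
  -- The indicator of `D₃` factors: each coordinate need only lie between `0` and its successor, the
  -- last between `0` and `1`.
  have e : ∀ x : ℝ × ℝ × ℝ × ℝ,
      D₃.indicator (fun x => f₁ x.1 * (f₂ x.2.1 * (f₃ x.2.2.1 * f₄ x.2.2.2))) x =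
      (Set.Ioo 0 x.2.1).indicator f₁ x.1 * ((Set.Ioo 0 x.2.2.1).indicator f₂ x.2.1 *
        ((Set.Ioo 0 x.2.2.2).indicator f₃ x.2.2.1 * (Set.Ioo 0 1).indicator f₄ x.2.2.2)) := by
    rintro ⟨t₁, u₁, t₂, u₂⟩
    by_cases h : (t₁, u₁, t₂, u₂) ∈ D₃
    · have ⟨a, b, c, d, e⟩ : 0 < t₁ ∧ t₁ < u₁ ∧ u₁ < t₂ ∧ t₂ < u₂ ∧ u₂ < 1 := h
      rw [Set.indicator_of_mem h, Set.indicator_of_mem, Set.indicator_of_mem,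
        Set.indicator_of_mem, Set.indicator_of_mem] <;> constructor <;> dsimp only <;> linarith
    · rw [Set.indicator_of_notMem h]
      symm
      by_contra hne
      simp only [mul_eq_zero, not_or, Set.indicator_apply_eq_zero, Classical.not_imp,
        Set.mem_Ioo] at hne
      exact h ⟨hne.1.1.1, hne.1.1.2, hne.2.1.1.2, hne.2.2.1.1.2, hne.2.2.2.1.2⟩
  rw [← lintegral_indicator measurableSet_D₃, lintegral_congr e]
  have s₁ := lintegral_indicator_mul (ν := (volume : Measure (ℝ × ℝ × ℝ))) h₁ (φ := Prod.fst)
    measurable_fst (R := fun y => (Set.Ioo 0 y.2.1).indicator f₂ y.1 *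
        ((Set.Ioo 0 y.2.2).indicator f₃ y.2.1 * (Set.Ioo 0 1).indicator f₄ y.2.2))
    ((k₂.comp (measurable_fst.prodMk (measurable_fst.comp measurable_snd))).mul
      ((k₃.comp measurable_snd).mul (k₄.comp (measurable_snd.comp measurable_snd))))
  refine s₁.trans ?_
  simp_rw [← mul_assoc, hswap, mul_assoc]
  have s₂ := lintegral_indicator_mul (ν := (volume : Measure (ℝ × ℝ))) (m₁.mul h₂) (φ := Prod.fst)
    measurable_fst (R := fun y => (Set.Ioo 0 y.2).indicator f₃ y.1 * (Set.Ioo 0 1).indicator f₄ y.2)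
    (k₃.mul (k₄.comp measurable_snd))
  refine s₂.trans ?_
  simp_rw [← mul_assoc, hswap]
  have s₃ := lintegral_indicator_mul (ν := (volume : Measure ℝ)) (m₂.mul h₃) (φ := id)
    measurable_id k₄
  refine s₃.trans ?_
  simp_rw [id, hswap]
  rw [lintegral_indicator measurableSet_Ioo]
  rfl

lemma primitive_congr {f g : ℝ → ℝ≥0∞} {s : ℝ} (h : ∀ t, 0 < t → t < s → f t = g t) :
    primitive f s = primitive g s :=
  setLIntegral_congr_fun measurableSet_Ioo fun t ht => h t ht.1 ht.2

lemma primitive_rpow {c s : ℝ} (C : ℝ) (hC : 0 ≤ C) (hc : 0 < c) (hs : 0 < s) :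
    primitive (fun t => ENNReal.ofReal (C * t ^ (c - 1))) s = ENNReal.ofReal (C / c * s ^ c) := by
  have hint : IntegrableOn (fun t : ℝ => t ^ (c - 1)) (Set.Ioo 0 s) :=
    (intervalIntegral.integrableOn_Ioo_rpow_iff hs).2 (by linarith)
  have hpos : 0 ≤ᵐ[volume.restrict (Set.Ioo 0 s)] fun t : ℝ => C * t ^ (c - 1) :=
    (ae_restrict_iff' measurableSet_Ioo).2
      (ae_of_all _ fun t ht => mul_nonneg hC (Real.rpow_nonneg ht.1.le _))
  rw [primitive, ← ofReal_integral_eq_lintegral_ofReal (hint.const_mul C) hpos,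
    ← integral_Ioc_eq_integral_Ioo, ← intervalIntegral.integral_of_le hs.le,
    intervalIntegral.integral_const_mul, integral_rpow (Or.inl (by linarith))]
  congr 1
  rw [sub_add_cancel, Real.zero_rpow hc.ne']
  ring

/-- The beta distribution has total mass one. -/
lemma primitive_beta {a b C : ℝ} (hC : 0 ≤ C) (ha : 0 < a) (hb : 0 < b) :
    primitive (fun u => ENNReal.ofReal (C * (u ^ (a - 1) * (1 - u) ^ (b - 1)))) 1 =
      ENNReal.ofReal (C * ProbabilityTheory.beta a b) := by
  have hβ := ProbabilityTheory.beta_pos ha hb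
  have h := ProbabilityTheory.lintegral_betaPDF_eq_one ha hb
  rw [ProbabilityTheory.lintegral_betaPDF] at h
  have e : ∀ u : ℝ, ENNReal.ofReal (C * (u ^ (a - 1) * (1 - u) ^ (b - 1))) =
      ENNReal.ofReal (C * ProbabilityTheory.beta a b) *
        ENNReal.ofReal (1 / ProbabilityTheory.beta a b * u ^ (a - 1) * (1 - u) ^ (b - 1)) := by
    intro u
    rw [← ENNReal.ofReal_mul (by positivity)]
    congr 1
    field_simp
  rw [primitive, lintegral_congr e, lintegral_const_mul' _ _ ENNReal.ofReal_ne_top, h, mul_one]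

/-- Each of the first three integrations divides by the exponent accumulated so far; the last is a
Beta integral. -/
lemma lintegral_D₃_rpow {c₁ c₂ c₃ c₄ b : ℝ} (h₁ : 0 < c₁) (h₂ : 0 < c₂) (h₃ : 0 < c₃)
    (h₄ : 0 < c₄) (hb : 0 < b) :
    ∫⁻ x in D₃, ENNReal.ofReal (x.1 ^ (c₁ - 1)) * (ENNReal.ofReal (x.2.1 ^ (c₂ - 1)) *
      (ENNReal.ofReal (x.2.2.1 ^ (c₃ - 1)) *
        ENNReal.ofReal (x.2.2.2 ^ (c₄ - 1) * (1 - x.2.2.2) ^ (b - 1)))) =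
      ENNReal.ofReal (1 / c₁ / (c₁ + c₂) / (c₁ + c₂ + c₃) *
        ProbabilityTheory.beta (c₁ + c₂ + c₃ + c₄) b) := by
  have hmul : ∀ {C c d t : ℝ}, 0 ≤ C → 0 < t →
      ENNReal.ofReal (C * t ^ c) * ENNReal.ofReal (t ^ (d - 1)) =
      ENNReal.ofReal (C * t ^ (c + d - 1)) := fun {C c d t} hC ht => by
    rw [← ENNReal.ofReal_mul (mul_nonneg hC (Real.rpow_nonneg ht.le _)), mul_assoc,
      ← Real.rpow_add ht, add_sub_assoc]
  have e₁ : ∀ s : ℝ, 0 < s → primitive (fun t => ENNReal.ofReal (t ^ (c₁ - 1))) s *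
      ENNReal.ofReal (s ^ (c₂ - 1)) = ENNReal.ofReal (1 / c₁ * s ^ (c₁ + c₂ - 1)) := by
    intro s hs
    have := primitive_rpow 1 zero_le_one h₁ hs
    simp_rw [one_mul] at this
    rw [this, hmul (by positivity) hs]
  have e₂ : ∀ s : ℝ, 0 < s → primitive (fun t => primitive
      (fun t => ENNReal.ofReal (t ^ (c₁ - 1))) t * ENNReal.ofReal (t ^ (c₂ - 1))) s *
      ENNReal.ofReal (s ^ (c₃ - 1)) =
      ENNReal.ofReal (1 / c₁ / (c₁ + c₂) * s ^ (c₁ + c₂ + c₃ - 1)) := by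
    intro s hs
    rw [primitive_congr fun t ht _ => e₁ t ht, primitive_rpow _ (by positivity) (by positivity) hs,
      hmul (by positivity) hs]
  rw [lintegral_D₃_mul (f₁ := fun t => ENNReal.ofReal (t ^ (c₁ - 1)))
    (f₂ := fun t => ENNReal.ofReal (t ^ (c₂ - 1))) (f₃ := fun t => ENNReal.ofReal (t ^ (c₃ - 1)))
    (f₄ := fun t => ENNReal.ofReal (t ^ (c₄ - 1) * (1 - t) ^ (b - 1)))
    (by fun_prop) (by fun_prop) (by fun_prop) (by fun_prop),
    ← primitive_beta (by positivity) (by positivity) hb]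
  refine primitive_congr fun u hu _ => ?_
  rw [primitive_congr fun t ht _ => e₂ t ht, primitive_rpow _ (by positivity) (by positivity) hu,
    ← ENNReal.ofReal_mul (by positivity)]
  congr 1
  rw [add_sub_assoc (c₁ + c₂ + c₃), Real.rpow_add hu (c₁ + c₂ + c₃)]
  ring

/-! ### Beta values and the binomial series. -/

/-- Iterate `B(a+1,b) = a/(a+b) · B(a,b)` from `B(1,1-x) = 1/(1-x)`. -/
lemma beta_succ_one_sub {x : ℝ} (hx : x < 1) (k : ℕ) :
    ProbabilityTheory.beta ((k : ℝ) + 1) (1 - x) =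
      1 / ((k : ℝ) + 1) * ∏ i ∈ Finset.range (k + 1), (1 - x / ((i : ℝ) + 1))⁻¹ := by
  have hx' : 0 < 1 - x := by linarith
  induction k with
  | zero =>
    have h := Real.Gamma_add_one hx'.ne'
    have hG := (Real.Gamma_pos_of_pos hx').ne'
    simp only [ProbabilityTheory.beta, Nat.cast_zero, zero_add, Real.Gamma_one]
    rw [add_comm, h]
    simp
    field_simp
  | succ k ih =>
    have hk : (0 : ℝ) < (k : ℝ) + 1 := by positivity
    have h1 := Real.Gamma_add_one hk.ne'
    have h2 := Real.Gamma_add_one (show (k : ℝ) + 1 + (1 - x) ≠ 0 by positivity)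
    have hstep : ProbabilityTheory.beta ((k : ℝ) + 1 + 1) (1 - x) =
        ((k : ℝ) + 1) / ((k : ℝ) + 1 + (1 - x)) * ProbabilityTheory.beta ((k : ℝ) + 1) (1 - x) := by
      rw [ProbabilityTheory.beta, ProbabilityTheory.beta, h1,
        show (k : ℝ) + 1 + 1 + (1 - x) = (k : ℝ) + 1 + (1 - x) + 1 by ring, h2]
      rw [div_mul_div_comm]
      ring
    rw [Nat.cast_succ, hstep, ih, Finset.prod_range_succ _ (k + 1)]
    have e : (1 - x / (((k + 1 : ℕ) : ℝ) + 1))⁻¹ = ((k : ℝ) + 1 + 1) / ((k : ℝ) + 1 + (1 - x)) := by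
      rw [inv_eq_iff_eq_inv, inv_div]
      push_cast
      field_simp
      ring
    rw [e]
    field_simp

lemma hasSum_one_sub_rpow {x t : ℝ} (ht0 : 0 ≤ t) (ht1 : t < 1) :
    HasSum (fun n : ℕ => (∏ i ∈ Finset.range n, (1 - x / ((i : ℝ) + 1))) * t ^ n)
      ((1 - t) ^ (x - 1)) := by
  -- The coefficient is the rising factorial of `1-x` over `n!`, that is `∏ (i+1-x)/(i+1)`.
  have hc : ∀ n : ℕ, Ring.choose (1 - x + n - 1) n =
      ∏ i ∈ Finset.range n, (1 - x / ((i : ℝ) + 1)) := by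
    intro n
    rw [← Ring.multichoose_eq]
    have h := Ring.factorial_nsmul_multichoose_eq_ascPochhammer (1 - x) n
    have hp : (ascPochhammer ℕ n).smeval (1 - x) =
        n.factorial * ∏ i ∈ Finset.range n, (1 - x / ((i : ℝ) + 1)) := by
      clear h
      induction n with
      | zero => simp
      | succ n ih =>
        rw [ascPochhammer_succ_right, Polynomial.smeval_mul, ih, Finset.prod_range_succ,
          Nat.factorial_succ]
        simp [Polynomial.smeval_add, Polynomial.smeval_natCast]
        field_simp
        ring
    rw [hp, nsmul_eq_mul] at h
    exact mul_left_cancel₀ (by positivity) h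
  have h := (Real.one_div_one_sub_rpow_hasFPowerSeriesOnBall_zero (1 - x)).hasSum (y := t) (by
    rw [← ENNReal.ofReal_one, Metric.eball_ofReal]
    simpa [abs_of_nonneg ht0] using ht1)
  have e : 1 / (1 - t) ^ (1 - x) = (1 - t) ^ (x - 1) := by
    rw [one_div, ← Real.rpow_neg (by linarith), neg_sub]
  simp only [zero_add] at h
  rw [e] at h
  rw [FormalMultilinearSeries.ofScalars_apply_eq'] at h
  simpa only [hc, smul_eq_mul] using h

/-! ### The generating function of the integrals. -/

/-- The normalised integral defining `T m n`, as an extended nonnegative real. -/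
noncomputable def lintegralT (m n : ℕ) : ℝ≥0∞ :=
  ∫⁻ x in D₃, ENNReal.ofReal (1 / ((m.factorial : ℝ) * (n.factorial : ℝ)) * integrandT m n x)

lemma tsum_pow_mul_ofReal_div_factorial {x X : ℝ} (hx : 0 ≤ x) (hX : 0 ≤ X) :
    ∑' m : ℕ, ENNReal.ofReal x ^ m * ENNReal.ofReal (X ^ m / m.factorial) =
      ENNReal.ofReal (Real.exp (x * X)) := by
  have h := NormedSpace.expSeries_div_hasSum_exp (x * X)
  rw [← Real.exp_eq_exp_ℝ] at h
  rw [← h.tsum_eq, ENNReal.ofReal_tsum_of_nonneg (fun n => by positivity) h.summable]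
  refine tsum_congr fun m => ?_
  rw [← ENNReal.ofReal_pow hx, ← ENNReal.ofReal_mul (by positivity), mul_pow, mul_div_assoc]

lemma measurable_integrandT (m n : ℕ) : Measurable (integrandT m n) := by
  have : integrandT m n = fun x : ℝ × ℝ × ℝ × ℝ =>
      (Real.log ((1 - x.1) / (1 - x.2.2.2))) ^ m *
      (Real.log (x.2.2.1 / x.1) + Real.log (x.2.2.2 / x.2.1)) ^ n *
      (1 / ((1 - x.1) * x.2.2.1)) * (1 / ((1 - x.2.1) * x.2.2.2)) := rfl
  rw [this]
  fun_prop

/-- The three factors of the integrand are nonnegative on `D₃`. -/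
lemma factors_nonneg {t₁ u₁ t₂ u₂ : ℝ} (h : (t₁, u₁, t₂, u₂) ∈ D₃) :
    0 ≤ Real.log ((1 - t₁) / (1 - u₂)) ∧ 0 ≤ Real.log (t₂ / t₁) + Real.log (u₂ / u₁) ∧
      0 ≤ 1 / ((1 - t₁) * t₂) * (1 / ((1 - u₁) * u₂)) := by
  obtain ⟨h1, h2, h3, h4, h5⟩ : 0 < t₁ ∧ t₁ < u₁ ∧ u₁ < t₂ ∧ t₂ < u₂ ∧ u₂ < 1 := h
  have a1 : 0 < 1 - t₁ := by linarith
  have a2 : 0 < 1 - u₁ := by linarith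
  have a3 : 0 < 1 - u₂ := by linarith
  have a4 : 0 < u₁ := by linarith
  have a5 : 0 < t₂ := by linarith
  have a6 : 0 < u₂ := by linarith
  refine ⟨Real.log_nonneg ?_, add_nonneg (Real.log_nonneg ?_) (Real.log_nonneg ?_), by positivity⟩
  · rw [le_div_iff₀ a3]; linarith
  · rw [le_div_iff₀ h1]; linarith
  · rw [le_div_iff₀ a4]; linarith

lemma integrandT_nonneg (m n : ℕ) {x : ℝ × ℝ × ℝ × ℝ} (hx : x ∈ D₃) : 0 ≤ integrandT m n x := by
  obtain ⟨t₁, u₁, t₂, u₂⟩ := x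
  obtain ⟨h1, h2, h3⟩ := factors_nonneg hx
  rw [integrandT, mul_assoc]
  exact mul_nonneg (mul_nonneg (pow_nonneg h1 m) (pow_nonneg h2 n)) h3

lemma tsum_ofReal_integrandT {x y : ℝ} (hx : 0 ≤ x) (hy : 0 ≤ y) {t₁ u₁ t₂ u₂ : ℝ}
    (h : (t₁, u₁, t₂, u₂) ∈ D₃) :
    ∑' m : ℕ, ∑' n : ℕ, ENNReal.ofReal x ^ m * (ENNReal.ofReal y ^ n *
      ENNReal.ofReal (1 / ((m.factorial : ℝ) * (n.factorial : ℝ)) *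
        integrandT m n (t₁, u₁, t₂, u₂))) =
      ENNReal.ofReal (Real.exp (x * Real.log ((1 - t₁) / (1 - u₂))) *
        Real.exp (y * (Real.log (t₂ / t₁) + Real.log (u₂ / u₁))) *
        (1 / ((1 - t₁) * t₂) * (1 / ((1 - u₁) * u₂)))) := by
  obtain ⟨h1, h2, h3⟩ := factors_nonneg h
  rw [ENNReal.ofReal_mul (by positivity), ENNReal.ofReal_mul (by positivity),
    ← tsum_pow_mul_ofReal_div_factorial hx h1, ← tsum_pow_mul_ofReal_div_factorial hy h2,
    mul_assoc, ← ENNReal.tsum_mul_right]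
  refine tsum_congr fun m => ?_
  rw [← ENNReal.tsum_mul_right, ← ENNReal.tsum_mul_left]
  refine tsum_congr fun n => ?_
  have e : 1 / ((m.factorial : ℝ) * (n.factorial : ℝ)) * integrandT m n (t₁, u₁, t₂, u₂) =
      Real.log ((1 - t₁) / (1 - u₂)) ^ m / m.factorial *
        ((Real.log (t₂ / t₁) + Real.log (u₂ / u₁)) ^ n / n.factorial *
        (1 / ((1 - t₁) * t₂) * (1 / ((1 - u₁) * u₂)))) := by
    rw [integrandT, ← div_div]
    ring
  rw [e, ENNReal.ofReal_mul (by positivity), ENNReal.ofReal_mul (by positivity)]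
  ring

/-- The coefficients of `(1 - t) ^ (x - 1)`. -/
noncomputable def binomCoeff (x : ℝ) (j : ℕ) : ℝ :=
  ∏ i ∈ Finset.range j, (1 - x / ((i : ℝ) + 1))

lemma binomCoeff_nonneg {x : ℝ} (hx : x < 1) (j : ℕ) : 0 ≤ binomCoeff x j :=
  Finset.prod_nonneg fun i _ => (sub_pos.2 (div_succ_lt_one hx i)).le

lemma tsum_ofReal_mul_rpow {c : ℕ → ℝ} (hc : ∀ j, 0 ≤ c j) {t S y : ℝ} (ht : 0 < t)
    (h : HasSum (fun j => c j * t ^ j) S) :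
    ∑' j : ℕ, ENNReal.ofReal (c j) * ENNReal.ofReal (t ^ ((j : ℝ) + 1 - y - 1)) =
      ENNReal.ofReal (S * t ^ (-y)) := by
  have h' := h.mul_right (t ^ (-y))
  rw [← h'.tsum_eq, ENNReal.ofReal_tsum_of_nonneg
    (fun j => mul_nonneg (mul_nonneg (hc j) (by positivity)) (by positivity)) h'.summable]
  refine tsum_congr fun j => ?_
  rw [← ENNReal.ofReal_mul (hc j), mul_assoc, ← Real.rpow_natCast t j, ← Real.rpow_add ht]
  congr 3
  ring

/-- Only `(1-t₁)^(x-1)` and `(1-u₁)⁻¹` are expanded; `(1-u₂)^(-x)` is kept for the Beta integral.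
Exponents are written as `c - 1` to fit `lintegral_D₃_rpow`. -/
lemma tsum_ofReal_monomials {x y : ℝ} (hx1 : x < 1) {t₁ u₁ t₂ u₂ : ℝ}
    (h : (t₁, u₁, t₂, u₂) ∈ D₃) :
    ∑' j : ℕ, ∑' l : ℕ, ENNReal.ofReal (binomCoeff x j) *
      (ENNReal.ofReal (t₁ ^ ((j : ℝ) + 1 - y - 1)) *
        (ENNReal.ofReal (u₁ ^ ((l : ℝ) + 1 - y - 1)) * (ENNReal.ofReal (t₂ ^ (y - 1)) *
          ENNReal.ofReal (u₂ ^ (y - 1) * (1 - u₂) ^ (1 - x - 1))))) =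
      ENNReal.ofReal (Real.exp (x * Real.log ((1 - t₁) / (1 - u₂))) *
        Real.exp (y * (Real.log (t₂ / t₁) + Real.log (u₂ / u₁))) *
        (1 / ((1 - t₁) * t₂) * (1 / ((1 - u₁) * u₂)))) := by
  obtain ⟨h1, h2, h3, h4, h5⟩ : 0 < t₁ ∧ t₁ < u₁ ∧ u₁ < t₂ ∧ t₂ < u₂ ∧ u₂ < 1 := h
  have a1 : 0 < 1 - t₁ := by linarith
  have a2 : 0 < 1 - u₁ := by linarith
  have a3 : 0 < 1 - u₂ := by linarith
  have a4 : 0 < u₁ := by linarith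
  have a5 : 0 < t₂ := by linarith
  have a6 : 0 < u₂ := by linarith
  have s1 := tsum_ofReal_mul_rpow (y := y) (binomCoeff_nonneg hx1) h1
    (hasSum_one_sub_rpow (x := x) h1.le (by linarith))
  have s2 := tsum_ofReal_mul_rpow (c := fun _ => 1) (y := y) (fun _ => zero_le_one) a4
    (by simpa using hasSum_geometric_of_lt_one a4.le (by linarith))
  simp only [ENNReal.ofReal_one, one_mul] at s2
  simp_rw [ENNReal.tsum_mul_left, ENNReal.tsum_mul_right, ← mul_assoc]
  rw [ENNReal.tsum_mul_right, ENNReal.tsum_mul_right, ENNReal.tsum_mul_right, s1, s2,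
    ← ENNReal.ofReal_mul (by positivity), ← ENNReal.ofReal_mul (by positivity),
    ← ENNReal.ofReal_mul (by positivity)]
  congr 1
  have e1 : Real.exp (x * Real.log ((1 - t₁) / (1 - u₂))) = (1 - t₁) ^ x * ((1 - u₂) ^ x)⁻¹ := by
    rw [mul_comm, ← Real.rpow_def_of_pos (by positivity), Real.div_rpow a1.le a3.le, div_eq_mul_inv]
  have e2 : Real.exp (y * (Real.log (t₂ / t₁) + Real.log (u₂ / u₁))) =
      t₂ ^ y * (t₁ ^ y)⁻¹ * (u₂ ^ y * (u₁ ^ y)⁻¹) := by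
    rw [mul_add, Real.exp_add, mul_comm y, mul_comm y, ← Real.rpow_def_of_pos (by positivity),
      ← Real.rpow_def_of_pos (by positivity), Real.div_rpow a5.le h1.le,
      Real.div_rpow a6.le a4.le, div_eq_mul_inv, div_eq_mul_inv]
  have e3 : 1 - x - 1 = -x := by ring
  rw [e1, e2, e3, Real.rpow_sub_one a1.ne', Real.rpow_sub_one a5.ne', Real.rpow_sub_one a6.ne',
    Real.rpow_neg h1.le, Real.rpow_neg a4.le, Real.rpow_neg a3.le]
  field_simp

/-- Tonelli on both expansions. Strict positivity of `y` is needed because `t₂` and `u₂` carry the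
exponent `y - 1`. -/
lemma tsum_lintegralT {x y : ℝ} (hx0 : 0 ≤ x) (hx1 : x < 1) (hy0 : 0 < y) (hy1 : y < 1) :
    ∑' m, ENNReal.ofReal x ^ m * ∑' n, ENNReal.ofReal y ^ n * lintegralT m n =
      ∑' j : ℕ, ∑' l : ℕ, ENNReal.ofReal (binomCoeff x j) *
        ENNReal.ofReal (1 / ((j : ℝ) + 1 - y) / (((j : ℝ) + 1 - y) + ((l : ℝ) + 1 - y)) /
          (((j : ℝ) + 1 - y) + ((l : ℝ) + 1 - y) + y) *
          ProbabilityTheory.beta (((j : ℝ) + 1 - y) + ((l : ℝ) + 1 - y) + y + y) (1 - x)) := by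
  have hm : ∀ m n : ℕ, Measurable fun z => ENNReal.ofReal
      (1 / ((m.factorial : ℝ) * (n.factorial : ℝ)) * integrandT m n z) := fun m n =>
    ((measurable_integrandT m n).const_mul _).ennreal_ofReal
  have hL : ∑' m, ENNReal.ofReal x ^ m * ∑' n, ENNReal.ofReal y ^ n * lintegralT m n =
      ∫⁻ z in D₃, ∑' m : ℕ, ∑' n : ℕ, ENNReal.ofReal x ^ m * (ENNReal.ofReal y ^ n *
      ENNReal.ofReal (1 / ((m.factorial : ℝ) * (n.factorial : ℝ)) * integrandT m n z)) := by
    rw [lintegral_tsum fun m => (Measurable.tsum fun n =>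
      ((hm m n).const_mul _).const_mul _).aemeasurable]
    refine tsum_congr fun m => ?_
    rw [lintegral_tsum fun n => (((hm m n).const_mul _).const_mul _).aemeasurable,
      ← ENNReal.tsum_mul_left]
    refine tsum_congr fun n => ?_
    rw [lintegral_const_mul _ ((hm m n).const_mul _), lintegral_const_mul _ (hm m n), lintegralT]
  have hR : ∀ (j l : ℕ), Measurable fun z : ℝ × ℝ × ℝ × ℝ =>
      (ENNReal.ofReal (z.1 ^ ((j : ℝ) + 1 - y - 1)) *
        (ENNReal.ofReal (z.2.1 ^ ((l : ℝ) + 1 - y - 1)) * (ENNReal.ofReal (z.2.2.1 ^ (y - 1)) *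
          ENNReal.ofReal (z.2.2.2 ^ (y - 1) * (1 - z.2.2.2) ^ (1 - x - 1))))) := by
    intro j l
    fun_prop
  have hj : ∀ j : ℕ, 0 < (j : ℝ) + 1 - y := fun j => by
    have : (0 : ℝ) ≤ j := by positivity
    linarith
  have hmid : ∀ z ∈ D₃, ∑' m : ℕ, ∑' n : ℕ, ENNReal.ofReal x ^ m * (ENNReal.ofReal y ^ n *
      ENNReal.ofReal (1 / ((m.factorial : ℝ) * (n.factorial : ℝ)) * integrandT m n z)) =
      ∑' j : ℕ, ∑' l : ℕ, ENNReal.ofReal (binomCoeff x j) *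
      (ENNReal.ofReal (z.1 ^ ((j : ℝ) + 1 - y - 1)) *
        (ENNReal.ofReal (z.2.1 ^ ((l : ℝ) + 1 - y - 1)) * (ENNReal.ofReal (z.2.2.1 ^ (y - 1)) *
          ENNReal.ofReal (z.2.2.2 ^ (y - 1) * (1 - z.2.2.2) ^ (1 - x - 1))))) := by
    rintro ⟨t₁, u₁, t₂, u₂⟩ hz
    rw [tsum_ofReal_integrandT hx0 hy0.le hz, tsum_ofReal_monomials hx1 hz]
  rw [hL, setLIntegral_congr_fun measurableSet_D₃ hmid,
    lintegral_tsum fun j => (Measurable.tsum fun l => (hR j l).const_mul _).aemeasurable]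
  refine tsum_congr fun j => ?_
  rw [lintegral_tsum fun l => ((hR j l).const_mul _).aemeasurable]
  refine tsum_congr fun l => ?_
  rw [lintegral_const_mul _ (hR j l), lintegral_D₃_rpow (hj j) (hj l) hy0 hy0 (by linarith)]

lemma tsum_add_succ (j : ℕ) (F : ℕ → ℝ≥0∞) :
    ∑' l, F (j + l + 1) = ∑' k, if j < k then F k else 0 := by
  have hinj : Function.Injective fun l : ℕ => j + l + 1 := fun a b h => by
    simpa using h
  rw [← hinj.tsum_eq (f := fun k => if j < k then F k else 0)]
  · exact tsum_congr fun l => by rw [if_pos (by omega)]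
  · intro k hk
    have : j < k := by
      by_contra h
      exact hk (if_neg h)
    exact ⟨k - j - 1, by dsimp only; omega⟩

/-- The generating function of the integrals `lintegralT m n` as a double series. -/
lemma tsum_lintegralT_eq {x y : ℝ} (hx0 : 0 ≤ x) (hx1 : x < 1) (hy0 : 0 < y) (hy1 : y < 1) :
    ∑' m, ENNReal.ofReal x ^ m * ∑' n, ENNReal.ofReal y ^ n * lintegralT m n =
      ∑' j : ℕ, ∑' k : ℕ, if j < k then chainProd (ENNReal.ofReal x) j k *
        (invSucc k * (ENNReal.ofReal (1 / ((j : ℝ) + 1 - y)) *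
          ENNReal.ofReal (1 / (((k : ℝ) + 1 - 2 * y) * ((k : ℝ) + 1 - y))))) else 0 := by
  rw [tsum_lintegralT hx0 hx1 hy0 hy1]
  refine tsum_congr fun j => ?_
  rw [← tsum_add_succ j]
  refine tsum_congr fun l => ?_
  have h0 : ∀ i : ℕ, 0 < 1 - x / ((i : ℝ) + 1) := fun i => sub_pos.2 (div_succ_lt_one hx1 i)
  have hj : (0 : ℝ) ≤ j := by positivity
  have hl : (0 : ℝ) ≤ l := by positivity
  have p1 : 0 < (j : ℝ) + 1 - y := by linarith
  have p2 : 0 < (j : ℝ) + l + 1 + 1 - 2 * y := by linarith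
  have p3 : 0 < (j : ℝ) + l + 1 + 1 - y := by linarith
  -- The binomial coefficient cancels the Beta factors with `i < j`, leaving the generating product
  -- of the chain sums.
  have hprod : binomCoeff x j * ∏ i ∈ Finset.range (j + l + 1 + 1), (1 - x / ((i : ℝ) + 1))⁻¹ =
      ∏ i ∈ Finset.Icc j (j + l + 1), (1 - x / ((i : ℝ) + 1))⁻¹ := by
    rw [← Finset.Ico_add_one_right_eq_Icc,
      ← Finset.prod_range_mul_prod_Ico _ (show j ≤ j + l + 1 + 1 by omega), ← mul_assoc,
      binomCoeff, ← Finset.prod_mul_distrib,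
      Finset.prod_eq_one fun i _ => mul_inv_cancel₀ (h0 i).ne', one_mul]
  have hP : 0 ≤ ∏ i ∈ Finset.Icc j (j + l + 1), (1 - x / ((i : ℝ) + 1))⁻¹ :=
    Finset.prod_nonneg fun i _ => (inv_pos.2 (h0 i)).le
  have hbeta : ProbabilityTheory.beta (((j : ℝ) + 1 - y) + ((l : ℝ) + 1 - y) + y + y) (1 - x) =
      1 / ((j : ℝ) + l + 1 + 1) *
        ∏ i ∈ Finset.range (j + l + 1 + 1), (1 - x / ((i : ℝ) + 1))⁻¹ := by
    have h := beta_succ_one_sub hx1 (j + l + 1)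
    push_cast at h
    rw [← h]
    congr 1
    ring
  rw [hbeta, chainProd_ofReal hx0 hx1, invSucc_eq_ofReal]
  push_cast
  rw [← ENNReal.ofReal_mul (binomCoeff_nonneg hx1 j), ← ENNReal.ofReal_mul (by positivity),
    ← ENNReal.ofReal_mul (by positivity), ← ENNReal.ofReal_mul hP, ← hprod]
  congr 1
  rw [show (j : ℝ) + 1 - y + ((l : ℝ) + 1 - y) = (j : ℝ) + l + 1 + 1 - 2 * y by ring,
    show (j : ℝ) + l + 1 + 1 - 2 * y + y = (j : ℝ) + l + 1 + 1 - y by ring]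
  field_simp

/-! ### The generating function of the zeta-star side. -/

/-- The part of the multiple zeta-star series of `(a, {1}^m, b)` with distinct extreme indices. -/
noncomputable def offDiagSum (a m b : ℕ) : ℝ≥0∞ :=
  ∑' j, ∑' k, if j < k then invSucc j ^ a * (invSucc k ^ b * chainSum m j k) else 0

/-- The weighted combination of off-diagonal sums that evaluates `lintegralT m n`. -/
noncomputable def weightedSum (m n : ℕ) : ℝ≥0∞ :=
  ∑ p ∈ antidiagonal n, ENNReal.ofReal (2 ^ (p.2 + 1) - 1) * offDiagSum (p.1 + 1) m (p.2 + 3)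

/-- One factor `invSucc k` is set apart to match the `1/(k+1)` of the Beta value; the inner sum is
then a Cauchy product coefficient in `y`. -/
lemma weightedSum_eq (m n : ℕ) :
    weightedSum m n = ∑' j, ∑' k, if j < k then chainSum m j k * (invSucc k *
      ∑ p ∈ antidiagonal n, invSucc j ^ (p.1 + 1) *
        (ENNReal.ofReal (2 ^ (p.2 + 1) - 1) * invSucc k ^ (p.2 + 2))) else 0 := by
  rw [weightedSum]
  simp_rw [offDiagSum, ← ENNReal.tsum_mul_left]
  rw [← Summable.tsum_finsetSum fun _ _ => ENNReal.summable]
  refine tsum_congr fun j => ?_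
  rw [← Summable.tsum_finsetSum fun _ _ => ENNReal.summable]
  refine tsum_congr fun k => ?_
  split_ifs
  · rw [Finset.mul_sum, Finset.mul_sum]
    refine Finset.sum_congr rfl fun p _ => ?_
    rw [pow_succ (invSucc k) (p.2 + 2)]
    ring
  · simp

lemma tsum_weightedSum_eq {x y : ℝ} (hy0 : 0 ≤ y) (hy1 : 2 * y < 1) :
    ∑' m, ENNReal.ofReal x ^ m * ∑' n, ENNReal.ofReal y ^ n * weightedSum m n =
      ∑' j : ℕ, ∑' k : ℕ, if j < k then chainProd (ENNReal.ofReal x) j k *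
        (invSucc k * (ENNReal.ofReal (1 / ((j : ℝ) + 1 - y)) *
          ENNReal.ofReal (1 / (((k : ℝ) + 1 - 2 * y) * ((k : ℝ) + 1 - y))))) else 0 := by
  have h1 : ∀ m, ∑' n, ENNReal.ofReal y ^ n * weightedSum m n =
      ∑' j : ℕ, ∑' k : ℕ, if j < k then chainSum m j k *
        (invSucc k * (ENNReal.ofReal (1 / ((j : ℝ) + 1 - y)) *
          ENNReal.ofReal (1 / (((k : ℝ) + 1 - 2 * y) * ((k : ℝ) + 1 - y))))) else 0 := by
    intro m
    simp_rw [weightedSum_eq, ← ENNReal.tsum_mul_left]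
    rw [ENNReal.tsum_comm]
    refine tsum_congr fun j => ?_
    rw [ENNReal.tsum_comm]
    refine tsum_congr fun k => ?_
    rw [← tsum_pow_mul_invSucc_pow hy0 (by linarith), ← tsum_pow_mul_two_pow_sub_one hy0 hy1,
      tsum_pow_mul_tsum_pow]
    split_ifs
    · rw [← ENNReal.tsum_mul_left, ← ENNReal.tsum_mul_left]
      exact tsum_congr fun n => by ring
    · simp
  simp_rw [h1, ← ENNReal.tsum_mul_left]
  rw [ENNReal.tsum_comm]
  refine tsum_congr fun j => ?_
  rw [ENNReal.tsum_comm]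
  refine tsum_congr fun k => ?_
  rw [← tsum_pow_mul_chainSum]
  split_ifs
  · rw [← ENNReal.tsum_mul_right]
    exact tsum_congr fun n => by ring
  · simp

/-- For `y ≤ 1/4` one has `j+1-y ≥ (j+1)/2` and `(k+1-2y)(k+1-y) ≥ (k+1)/4`, whence the constant
`8`. A single power of `k+1` suffices here because `invSucc k` supplies the second. -/
lemma tsum_weightedSum_ne_top {y : ℝ} (hy0 : 0 ≤ y) (hy1 : y ≤ 1 / 4) :
    ∑' m, ENNReal.ofReal (1 / 4) ^ m * ∑' n, ENNReal.ofReal y ^ n * weightedSum m n ≠ ∞ := by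
  rw [tsum_weightedSum_eq hy0 (by linarith)]
  have hb : ∀ j k : ℕ, (if j < k then chainProd (ENNReal.ofReal (1 / 4)) j k *
        (invSucc k * (ENNReal.ofReal (1 / ((j : ℝ) + 1 - y)) *
          ENNReal.ofReal (1 / (((k : ℝ) + 1 - 2 * y) * ((k : ℝ) + 1 - y))))) else 0) ≤
      8 * (if j ≤ k then
        invSucc j * (invSucc k ^ 2 * chainProd (ENNReal.ofReal (1 / 4)) j k) else 0) := by
    intro j k
    split_ifs with h h'
    · have hj : (0 : ℝ) ≤ j := by positivity
      have hk : (0 : ℝ) ≤ k := by positivity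
      have b1 : ENNReal.ofReal (1 / ((j : ℝ) + 1 - y)) ≤ ENNReal.ofReal 2 * invSucc j := by
        rw [invSucc_eq_ofReal, ← ENNReal.ofReal_mul (by norm_num)]
        refine ENNReal.ofReal_le_ofReal ?_
        rw [mul_one_div]
        exact (div_le_div_iff₀ (by linarith) (by positivity)).2 (by linarith)
      have b2 : ENNReal.ofReal (1 / (((k : ℝ) + 1 - 2 * y) * ((k : ℝ) + 1 - y))) ≤
          ENNReal.ofReal 4 * invSucc k := by
        rw [invSucc_eq_ofReal, ← ENNReal.ofReal_mul (by norm_num)]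
        refine ENNReal.ofReal_le_ofReal ?_
        rw [mul_one_div]
        have q1 : ((k : ℝ) + 1) / 2 ≤ (k : ℝ) + 1 - 2 * y := by linarith
        have q2 : (1 : ℝ) / 2 ≤ (k : ℝ) + 1 - y := by linarith
        have q3 := mul_le_mul q1 q2 (by norm_num) (by linarith)
        exact (div_le_div_iff₀ (by nlinarith) (by positivity)).2 (by linarith)
      calc _ ≤ chainProd (ENNReal.ofReal (1 / 4)) j k * (invSucc k *
            ((ENNReal.ofReal 2 * invSucc j) * (ENNReal.ofReal 4 * invSucc k))) := by gcongr
        _ = _ := by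
          rw [show ENNReal.ofReal 2 = 2 by simp, show ENNReal.ofReal 4 = 4 by simp]
          ring
    · omega
    all_goals exact zero_le
  refine ne_top_of_le_ne_top ?_
    (ENNReal.tsum_le_tsum fun j => ENNReal.tsum_le_tsum fun k => hb j k)
  simp_rw [ENNReal.tsum_mul_left]
  exact ENNReal.mul_ne_top (by simp) tsum_chainProd_ne_top

lemma lintegralT_eq_weightedSum (m n : ℕ) :
    lintegralT m n = weightedSum m n ∧ weightedSum m n ≠ ∞ := by
  have hq : (0 : ℝ) < 1 / 4 := by norm_num
  have h1 : ∀ y : ℝ, 0 < y → y ≤ 1 / 4 → ∀ m,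
      ∑' n, ENNReal.ofReal y ^ n * weightedSum m n =
        ∑' n, ENNReal.ofReal y ^ n * lintegralT m n := by
    intro y hy0 hy1
    -- First the coefficients of `x^m` are compared for fixed `y`, then those of `y^n` for fixed
    -- `m`. The weighted sums come first because their finiteness is the one known; that of the
    -- integrals follows.
    refine congrFun (eq_of_tsum_pow_eq hq (tsum_weightedSum_ne_top hy0.le hy1) fun x hx0 hx1 => ?_)
    rw [tsum_weightedSum_eq hy0.le (by linarith),
      tsum_lintegralT_eq hx0.le (by linarith) hy0 (by linarith)]
  have h2 := ne_top_of_tsum_pow_ne_top hq (tsum_weightedSum_ne_top hq.le le_rfl) m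
  exact ⟨(congrFun (eq_of_tsum_pow_eq hq h2 fun y hy0 hy1 => h1 y hy0 hy1 m) n).symm,
    ne_top_of_tsum_pow_ne_top hq h2 n⟩

/-! ### Finiteness and return to real values. -/

/-- `(1/4)^m * chainSum m j k` is a single term of the series for `chainProd` at `1/4`. -/
lemma tupleSum_onesBetween_ne_top {a b : ℕ} (m : ℕ) (ha : 1 ≤ a) (hb : 2 ≤ b) :
    tupleSum (onesBetween a m b) 0 ≠ ∞ := by
  have hw : ∀ i, invSucc i ≤ 1 := fun i => ENNReal.inv_le_one.2 le_add_self
  have h : ENNReal.ofReal (1 / 4) ^ m * tupleSum (onesBetween a m b) 0 ≠ ∞ := by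
    refine ne_top_of_le_ne_top tsum_chainProd_ne_top ?_
    rw [onesBetween, tupleSum_cons]
    simp_rw [if_pos (Nat.zero_le _), tupleSum_snoc_ones, ← ENNReal.tsum_mul_left]
    refine ENNReal.tsum_le_tsum fun j => ENNReal.tsum_le_tsum fun k => ?_
    split_ifs with hjk
    · have h3 : ENNReal.ofReal (1 / 4) ^ m * chainSum m j k ≤
          chainProd (ENNReal.ofReal (1 / 4)) j k := by
        rw [← tsum_pow_mul_chainSum]
        exact ENNReal.le_tsum m
      calc _ = invSucc j ^ a * (invSucc k ^ b * (ENNReal.ofReal (1 / 4) ^ m * chainSum m j k)) := by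
            ring
        _ ≤ invSucc j ^ 1 * (invSucc k ^ 2 * chainProd (ENNReal.ofReal (1 / 4)) j k) := by
            gcongr ?_ * (?_ * ?_)
            · exact pow_le_pow_right_of_le_one' (hw j) ha
            · exact pow_le_pow_right_of_le_one' (hw k) hb
        _ = _ := by rw [pow_one]
    · simp
  intro ht
  refine h ?_
  rw [ht, ENNReal.mul_top]
  exact pow_ne_zero _ (by simp)

lemma summable_zetaStarTerm {a b : ℕ} (m : ℕ) (ha : 1 ≤ a) (hb : 2 ≤ b) :
    Summable (zetaStarTerm (onesBetween a m b)) := by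
  have h := tupleSum_onesBetween_ne_top m ha hb
  rw [← tsum_ofReal_zetaStarTerm] at h
  refine (ENNReal.summable_toReal h).congr fun k => ENNReal.toReal_ofReal ?_
  exact Finset.prod_nonneg fun i _ => by positivity

lemma zetaStar_eq_toReal {r : ℕ} (α : Fin r → ℕ) : zetaStar α = (tupleSum α 0).toReal := by
  rw [← tsum_ofReal_zetaStarTerm, ENNReal.tsum_toReal_eq fun _ => ENNReal.ofReal_ne_top, zetaStar]
  refine tsum_congr fun k => (ENNReal.toReal_ofReal ?_).symm
  exact Finset.prod_nonneg fun i _ => by positivity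

lemma toReal_tsum_invSucc_pow {s : ℕ} (hs : 1 < s) :
    ((∑' k, invSucc k ^ s).toReal : ℂ) = riemannZeta s := by
  rw [zeta_eq_tsum_one_div_nat_add_one_cpow (by simpa using hs), ENNReal.tsum_toReal_eq,
    Complex.ofReal_tsum]
  · refine tsum_congr fun k => ?_
    rw [ENNReal.toReal_pow, invSucc_eq_ofReal, ENNReal.toReal_ofReal (by positivity)]
    simp
  · intro k
    rw [invSucc_eq_ofReal]
    simp

lemma toReal_offDiagSum {a b : ℕ} (m : ℕ) (ha : 1 ≤ a) (hb : 2 ≤ b) :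
    ((offDiagSum a m b).toReal : ℂ) =
      zetaStar (onesBetween a m b) - riemannZeta ((a + m + b : ℕ) : ℂ) := by
  have h := tupleSum_onesBetween_ne_top m ha hb
  rw [zetaStar_eq_toReal, ← toReal_tsum_invSucc_pow (by omega)]
  rw [tupleSum_onesBetween] at h ⊢
  rw [← offDiagSum] at h ⊢
  obtain ⟨h1, h2⟩ := ENNReal.add_ne_top.1 h
  rw [ENNReal.toReal_add h1 h2]
  push_cast
  ring

/-- The pair with `α₂ = 1` has weight `2^0 - 1 = 0`; the others are `(p.1+1, p.2+2)`. -/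
lemma sum_positivePairs {M : Type*} [AddCommMonoid M] (n : ℕ) (g : ℕ × ℕ → M)
    (hg : g (n + 2, 1) = 0) :
    ∑ α ∈ positivePairs (n + 3), g α = ∑ p ∈ antidiagonal n, g (p.1 + 1, p.2 + 2) := by
  symm
  refine Finset.sum_of_injOn (fun p => (p.1 + 1, p.2 + 2)) ?_ ?_ ?_ fun _ _ => rfl
  · rintro ⟨a, b⟩ _ ⟨c, d⟩ _ h
    simpa using h
  · rintro ⟨a, b⟩ h
    simp only [Finset.mem_coe, mem_antidiagonal, positivePairs, Finset.mem_filter] at h ⊢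
    omega
  · rintro ⟨a, b⟩ h1 h2
    simp only [mem_antidiagonal, positivePairs, Finset.mem_filter] at h1
    by_cases hb : b = 1
    · obtain rfl : a = n + 2 := by omega
      rw [hb, hg]
    · refine absurd ⟨(a - 1, b - 2), ?_, ?_⟩ h2
      · simp only [Finset.mem_coe, mem_antidiagonal]
        omega
      · simp only [Prod.mk.injEq]
        omega

/-! ### Integrability and evaluation of `T` and `J₃`. -/

lemma integrableOn_integrandT (m n : ℕ) : IntegrableOn (integrandT m n) D₃ := by
  have hc : (0 : ℝ) < 1 / ((m.factorial : ℝ) * (n.factorial : ℝ)) := by positivity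
  have h : IntegrableOn
      (fun x => 1 / ((m.factorial : ℝ) * (n.factorial : ℝ)) * integrandT m n x) D₃ := by
    refine (lintegral_ofReal_ne_top_iff_integrable
      ((measurable_integrandT m n).const_mul _).aestronglyMeasurable ?_).1 ?_
    · exact (ae_restrict_iff' measurableSet_D₃).2
        (ae_of_all _ fun x hx => mul_nonneg hc.le (integrandT_nonneg m n hx))
    · have h := lintegralT_eq_weightedSum m n
      have h' : lintegralT m n ≠ ∞ := h.1 ▸ h.2
      exact h'
  exact (integrable_const_mul_iff (IsUnit.mk0 _ hc.ne') _).1 h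

lemma T_eq_toReal (m n : ℕ) : T m n = (weightedSum m n).toReal := by
  rw [T, ← integral_const_mul, ← (lintegralT_eq_weightedSum m n).1, lintegralT]
  refine integral_eq_lintegral_of_nonneg_ae ?_
    ((measurable_integrandT m n).const_mul _).aestronglyMeasurable
  exact (ae_restrict_iff' measurableSet_D₃).2
    (ae_of_all _ fun x hx => mul_nonneg (by positivity) (integrandT_nonneg m n hx))

lemma T_eq_sum (m n : ℕ) :
    (T m n : ℂ) = ∑ α ∈ positivePairs (n + 3),
      ((zetaStar (onesBetween α.1 m (α.2 + 1)) : ℂ) - riemannZeta ((m : ℂ) + (n : ℂ) + 4)) *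
        ((2 : ℂ) ^ (α.2 - 1) - 1) := by
  have hp : ∀ c : ℕ, (0 : ℝ) ≤ 2 ^ (c + 1) - 1 := fun c =>
    sub_nonneg.2 (one_le_pow₀ (by norm_num))
  have hfin := (lintegralT_eq_weightedSum m n).2
  rw [weightedSum] at hfin
  rw [sum_positivePairs n _ (by simp), T_eq_toReal, weightedSum,
    ENNReal.toReal_sum fun p hpm => (ENNReal.sum_ne_top.1 hfin) p hpm, Complex.ofReal_sum]
  refine Finset.sum_congr rfl fun p hpm => ?_
  rw [ENNReal.toReal_mul, ENNReal.toReal_ofReal (hp _), Complex.ofReal_mul,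
    toReal_offDiagSum m (by omega) (by omega), mul_comm]
  have hw : ((p.1 + 1 + m + (p.2 + 3) : ℕ) : ℂ) = (m : ℂ) + (n : ℂ) + 4 := by
    rw [← mem_antidiagonal.1 hpm]
    push_cast
    ring
  rw [hw]
  simp

lemma integrandJ_eq_sum (p : ℕ) (x : ℝ × ℝ × ℝ × ℝ) :
    integrandJ p x = ∑ q ∈ antidiagonal p, (p.choose q.1 : ℝ) * integrandT q.1 q.2 x := by
  obtain ⟨t₁, u₁, t₂, u₂⟩ := x
  rw [integrandJ, add_assoc, (Commute.all _ _).add_pow', Finset.sum_mul, Finset.sum_mul]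
  refine Finset.sum_congr rfl fun q _ => ?_
  rw [integrandT, nsmul_eq_mul]
  ring

lemma integrableOn_integrandJ (p : ℕ) : IntegrableOn (integrandJ p) D₃ := by
  rw [funext (integrandJ_eq_sum p)]
  exact integrable_finsetSum _ fun q _ => (integrableOn_integrandT q.1 q.2).const_mul _

/-- Binomial theorem: `choose p m / p! = 1/(m! n!)` when `m + n = p`. -/
lemma J₃_eq_sum_T (p : ℕ) : J₃ p = ∑ q ∈ antidiagonal p, T q.1 q.2 := by
  rw [J₃, funext (integrandJ_eq_sum p), integral_finsetSum _ fun q _ =>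
    (integrableOn_integrandT q.1 q.2).const_mul _, Finset.mul_sum]
  refine Finset.sum_congr rfl fun q hq => ?_
  rw [integral_const_mul, T, ← mul_assoc]
  congr 1
  have hq' := mem_antidiagonal.1 hq
  rw [← hq', Nat.cast_add_choose]
  field_simp

end ZetaStar

theorem mainTheorem6 :
    (∀ m n : ℕ,
      IntegrableOn (integrandT m n) D₃ ∧
      (∀ α ∈ positivePairs (n + 3), Summable (zetaStarTerm (onesBetween α.1 m (α.2 + 1)))) ∧
      (T m n : ℂ) =
        ∑ α ∈ positivePairs (n + 3),
          ((zetaStar (onesBetween α.1 m (α.2 + 1)) : ℂ) - riemannZeta ((m : ℂ) + (n : ℂ) + 4)) *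
            ((2 : ℂ) ^ (α.2 - 1) - 1)) ∧
    (∀ p : ℕ,
      IntegrableOn (integrandJ p) D₃ ∧
      (J₃ p : ℂ) =
        ∑ q ∈ Finset.HasAntidiagonal.antidiagonal p, ∑ α ∈ positivePairs (q.2 + 3),
          ((zetaStar (onesBetween α.1 q.1 (α.2 + 1)) : ℂ) - riemannZeta ((p : ℂ) + 4)) *
            ((2 : ℂ) ^ (α.2 - 1) - 1)) := by
  refine ⟨fun m n => ⟨ZetaStar.integrableOn_integrandT m n, fun α hα => ?_, ZetaStar.T_eq_sum m n⟩,
    fun p => ⟨ZetaStar.integrableOn_integrandJ p, ?_⟩⟩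
  · have h := (Finset.mem_filter.1 hα).2
    exact ZetaStar.summable_zetaStarTerm m h.1 (Nat.succ_le_succ h.2)
  · rw [ZetaStar.J₃_eq_sum_T, Complex.ofReal_sum]
    refine Finset.sum_congr rfl fun q hq => ?_
    rw [ZetaStar.T_eq_sum, ← mem_antidiagonal.1 hq]
    push_cast
    rfl
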